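/- Let $x_F = 0100101001001\ldots$ be the Fibonacci word, i.e. the infinite fixed point of the morphism $0 \mapsto 01$, $1 \mapsto 0$. Let $w$ be a non-empty factor of $x_F$ that has no overlap in $x_F$, i.e. there are no non-empty words $x, y, z$ such that $w = xy = yz$ and $xyz$ is a factor of $x_F$. Let $T(x_F)$ be the infinite word over $\{0,1,2\}$ obtained from $x_F$ by replacing, from left to right, each occurrence of $w$ by the letter $2$. Write $x_F = r_0(w)\, r_1(w)\, r_2(w) \cdots$, where $r_0(w)$ is the (possibly empty) prefix of $x_F$ that precedes the first occurrence of $w$ and, for $k \ge 1$, $r_k(w)$ is the word that extends from the beginning of the $k$-th occurrence of $w$ in $x_F$ up to the beginning of the $(k+1)$-st. Put $l_1 = |r_1(w)| - |w| + 1$ and $l_2 = |r_2(w)| - |w| + 1$, and let $\varphi = (1+\sqrt5)/2$. Then the letter $2$ occurs infinitely often in $T(x_F)$, and the increasing sequence $Y(1) < Y(2) < \cdots$ of its positions (counted from $1$) is a generalized Beatty sequence: for all $n \ge 1$, $$Y(n) = p \lfloor n\varphi \rfloor + q n + r, \qquad p = l_1 - l_2, \quad q = 2 l_2 - l_1, \quad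 r = |r_0(w)| - l_2 + 1.$$ -/

import Mathlib

namespace FibKimberling

/-- The Fibonacci morphism `0 ↦ 01, 1 ↦ 0` on letters. -/
def fibLetter (a : Fin 2) : List (Fin 2) := if a = 0 then [0, 1] else [0]

/-- The Fibonacci morphism on finite words. -/
def fibMorphism (w : List (Fin 2)) : List (Fin 2) := w.flatMap fibLetter

/-- The iterates of the Fibonacci morphism on the letter `0`: `0, 01, 010, 01001, …`. -/
def fibIter (n : ℕ) : List (Fin 2) := fibMorphism^[n] [0]

theorem fibIter_succ (n : ℕ) : fibIter (n + 1) = fibMorphism (fibIter n) :=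
  Function.iterate_succ_apply' _ _ _

theorem length_le_fibMorphism (w : List (Fin 2)) : w.length ≤ (fibMorphism w).length := by
  induction w with
  | nil => simp
  | cons a t ih =>
    have h : 1 ≤ (fibLetter a).length := by unfold fibLetter; split <;> simp
    simp only [fibMorphism, List.flatMap_cons, List.length_append, List.length_cons] at ih ⊢
    omega

theorem exists_fibIter_eq_cons (n : ℕ) : ∃ t, fibIter n = 0 :: t := by
  induction n with
  | zero => exact ⟨[], rfl⟩
  | succ n ih =>
    obtain ⟨t, ht⟩ := ih
    exact ⟨1 :: fibMorphism t, by rw [fibIter_succ, ht]; rfl⟩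

theorem lt_length_fibIter (n : ℕ) : n < (fibIter n).length := by
  induction n with
  | zero => simp [fibIter]
  | succ n ih =>
    obtain ⟨t, ht⟩ := exists_fibIter_eq_cons n
    have h := length_le_fibMorphism t
    have e : fibIter (n + 1) = 0 :: 1 :: fibMorphism t := by rw [fibIter_succ, ht]; rfl
    rw [e]
    rw [ht] at ih
    simp only [List.length_cons] at ih ⊢
    omega

/-- The Fibonacci word `0100101001001…`, the fixed point of the Fibonacci morphism; its letters
are numbered from `0`. Each iterate `fibIter n` is a prefix of the next one. -/
def fibWord (n : ℕ) : Fin 2 := (fibIter n)[n]'(lt_length_fibIter n)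

/-- The word `x i, x (i+1), …, x (i+n-1)`. -/
def slice {A : Type*} (x : ℕ → A) (i n : ℕ) : List A := (List.range n).map fun k => x (i + k)

/-- The finite word `w` occurs in `x`, starting at the index `i`. -/
def OccursAt {A : Type*} (x : ℕ → A) (w : List A) (i : ℕ) : Prop := slice x i w.length = w

instance {A : Type*} [DecidableEq A] (x : ℕ → A) (w : List A) (i : ℕ) :
    Decidable (OccursAt x w i) := inferInstanceAs (Decidable (slice x i w.length = w))

/-- `w` is a factor of the infinite word `x`. -/
def IsFactor {A : Type*} (x : ℕ → A) (w : List A) : Prop := ∃ i, OccursAt x w i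

/-- `w` has an overlap in `x`: `w = ab = bc` with `a, b, c` non-empty and `abc` a factor of `x`. -/
def HasOverlap {A : Type*} (x : ℕ → A) (w : List A) : Prop :=
  ∃ a b c : List A, a ≠ [] ∧ b ≠ [] ∧ c ≠ [] ∧ w = a ++ b ∧ w = b ++ c ∧ IsFactor x (a ++ b ++ c)

/-- The index at which the left-to-right replacement procedure stands in the Fibonacci word
after it has written `k` letters: an occurrence of `w` is consumed as a whole,
otherwise a single letter is consumed. -/
def readIndex (w : List (Fin 2)) : ℕ → ℕ
  | 0 => 0
  | k + 1 =>
    if OccursAt fibWord w (readIndex w k) then readIndex w k + w.length else readIndex w k + 1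

/-- The transform `[w ↦ 2]` of the Fibonacci word: the occurrences of `w` are replaced,
from left to right, by the letter `2`, and the other letters are kept. -/
def transform (w : List (Fin 2)) (k : ℕ) : Fin 3 :=
  if OccursAt fibWord w (readIndex w k) then 2 else (fibWord (readIndex w k)).castSucc

/-- `m` is a position of the letter `a` in `x`, where positions are counted from `1`. -/
def IsPosition {A : Type*} (x : ℕ → A) (a : A) (m : ℕ) : Prop := 1 ≤ m ∧ x (m - 1) = a

/-- The increasing sequence `Y(1) < Y(2) < …` of the positions of the letter `a` in `x`
(meaningful for `n ≥ 1`, when there are at least `n` such positions). -/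
noncomputable def positionSeq {A : Type*} (x : ℕ → A) (a : A) (n : ℕ) : ℕ :=
  Nat.nth (IsPosition x a) (n - 1)

/-- The index of the `k`-th occurrence of `w` in `x`, with `k = 0` for the first occurrence. -/
noncomputable def occurrence {A : Type*} (x : ℕ → A) (w : List A) (k : ℕ) : ℕ :=
  Nat.nth (OccursAt x w) k

/-- The words of the decomposition `x = r₀(w) r₁(w) r₂(w) …`: the word `r₀(w)` precedes the first
occurrence of `w`, and `r_k(w)`, `k ≥ 1`, reaches from the `k`-th occurrence of `w` up to
the next one. -/
noncomputable def returnWord {A : Type*} (x : ℕ → A) (w : List A) : ℕ → List A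
  | 0 => slice x 0 (occurrence x w 0)
  | k + 1 => slice x (occurrence x w k) (occurrence x w (k + 1) - occurrence x w k)

/-- The generalized Beatty sequence `V(n) = p ⌊n α⌋ + q n + r`. -/
noncomputable def generalizedBeatty (α : ℝ) (p q r : ℤ) (n : ℕ) : ℤ :=
  p * ⌊(n : ℝ) * α⌋ + q * n + r

end FibKimberling

/-!
Let `σ` be the Fibonacci morphism and let the `n`-th block of `fibWord = σ(fibWord)` be the image
of the letter number `n`. Every `0` starts a block and every `1` ends the block of a `0`, so the
occurrences of a non-empty factor `w` are obtained from those of a factor `u`, with an occurrence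
that ends earlier, by `p ↦ blockStart p` or `p ↦ blockStart p + 1`. With `Z(n)` the number of
zeros among the first `n` letters, `blockStart n = n + Z(n)` and `Z(blockStart n) = n`; by descent
to the empty word, whose occurrences are all the indices,
the `n`-th occurrence of `w` is thus `a Z(n) + b n + c` for constants `a, b, c`, which are
recovered from the first three return words. Finally the zeros of the Fibonacci word form the lower
Wythoff sequence, that is `⌊(n + 1)φ⌋ = blockStart n + 1`. If `w` has no overlap, then the
replacement meets every occurrence of `w`, and each earlier one shifts the position of the letter
`2` by `|w| - 1`.
-/

namespace FibKimberling

section Words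

variable {A : Type*} {x : ℕ → A} {u v w : List A} {i j : ℕ}

theorem length_slice (x : ℕ → A) (i n : ℕ) : (slice x i n).length = n := by
  simp [slice]

theorem slice_add (x : ℕ → A) (i m n : ℕ) :
    slice x i (m + n) = slice x i m ++ slice x (i + m) n := by
  simp [slice, List.range_add, Function.comp_def, add_assoc]

theorem slice_succ (x : ℕ → A) (i n : ℕ) : slice x i (n + 1) = slice x i n ++ [x (i + n)] := by
  simp [slice, List.range_succ]

theorem slice_ne_nil (x : ℕ → A) (i : ℕ) {n : ℕ} (hn : 0 < n) : slice x i n ≠ [] :=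
  List.ne_nil_of_length_pos (by rwa [length_slice])

theorem occursAt_slice (x : ℕ → A) (i n : ℕ) : OccursAt x (slice x i n) i := by
  rw [OccursAt, length_slice]

theorem occursAt_nil (x : ℕ → A) (i : ℕ) : OccursAt x [] i := rfl

theorem occursAt_append_iff :
    OccursAt x (u ++ v) i ↔ OccursAt x u i ∧ OccursAt x v (i + u.length) := by
  rw [OccursAt, List.length_append, slice_add]
  refine ⟨fun h => List.append_inj h (length_slice x i u.length), fun ⟨hu, hv⟩ => ?_⟩
  rw [hu, hv]

theorem occursAt_singleton_iff {a : A} : OccursAt x [a] i ↔ x i = a := by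
  simp [OccursAt, slice]

theorem occursAt_cons_iff {a : A} : OccursAt x (a :: w) i ↔ x i = a ∧ OccursAt x w (i + 1) := by
  rw [← List.singleton_append, occursAt_append_iff, occursAt_singleton_iff, List.length_singleton]

theorem OccursAt.prefix_of_length_le (hu : OccursAt x u i) (hv : OccursAt x v i)
    (h : u.length ≤ v.length) : u <+: v := by
  obtain ⟨d, hd⟩ := Nat.exists_eq_add_of_le h
  refine ⟨slice x (i + u.length) d, ?_⟩
  nth_rw 1 [← hu]
  rw [← slice_add, ← hd, hv]

theorem add_length_le_of_not_hasOverlap (hov : ¬ HasOverlap x w) (hij : i < j)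
    (hi : OccursAt x w i) (hj : OccursAt x w j) : i + w.length ≤ j := by
  by_contra! hlt
  obtain ⟨d, rfl⟩ := Nat.exists_eq_add_of_le hij.le
  obtain ⟨e, he⟩ := Nat.exists_eq_add_of_le (by omega : d ≤ w.length)
  refine hov ⟨slice x i d, slice x (i + d) e, slice x (i + d + e) d, slice_ne_nil x _ (by omega),
    slice_ne_nil x _ (by omega), slice_ne_nil x _ (by omega), ?_, ?_, i, ?_⟩
  · rw [← slice_add, ← he, hi]
  · rw [← slice_add, add_comm e, ← he, hj]
  · rw [← slice_add, add_assoc i, ← slice_add]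
    exact occursAt_slice x i _

theorem nth_eq_of_strictMono {p : ℕ → Prop} {f : ℕ → ℕ} (hf : StrictMono f)
    (hp : ∀ m, p m ↔ m ∈ Set.range f) (n : ℕ) : Nat.nth p n = f n := by
  have hinf : {m | p m}.Infinite :=
    Set.infinite_of_injective_forall_mem hf.injective fun t => (hp _).2 ⟨t, rfl⟩
  have hpf : (fun t => p (f t)) = fun _ => True := funext fun t => eq_true ((hp _).2 ⟨t, rfl⟩)
  rw [← Nat.nth_comp_of_strictMono hf (fun m => (hp m).1) fun hfin => absurd hfin hinf, hpf,
    Nat.nth_true]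

theorem positionSeq_succ {a : A} (hinf : {k | x k = a}.Infinite) (n : ℕ) :
    positionSeq x a (n + 1) = Nat.nth (fun k => x k = a) n + 1 := by
  refine nth_eq_of_strictMono ((Nat.nth_strictMono hinf).add_const 1) (fun m => ?_) n
  constructor
  · rintro ⟨hm, ha⟩
    classical
    refine ⟨Nat.count (fun k => x k = a) (m - 1), ?_⟩
    have hnth := Nat.nth_count (p := fun k => x k = a) ha
    exact (congrArg (· + 1) hnth).trans (Nat.sub_add_cancel hm)
  · rintro ⟨t, rfl⟩
    exact ⟨Nat.le_add_left 1 _, Nat.nth_mem_of_infinite hinf t⟩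

theorem infinite_isPosition {a : A} (hinf : {k | x k = a}.Infinite) :
    {m | IsPosition x a m}.Infinite :=
  (hinf.image Nat.succ_injective.injOn).mono <| by
    rintro _ ⟨k, hk, rfl⟩
    exact ⟨Nat.le_add_left 1 k, hk⟩

end Words

section FixedPoint

theorem fibMorphism_append (u v : List (Fin 2)) :
    fibMorphism (u ++ v) = fibMorphism u ++ fibMorphism v :=
  List.flatMap_append

theorem fibMorphism_singleton (a : Fin 2) : fibMorphism [a] = fibLetter a :=
  List.flatMap_singleton fibLetter a

theorem fibMorphism_prefix {u v : List (Fin 2)} (h : u <+: v) :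
    fibMorphism u <+: fibMorphism v := by
  obtain ⟨t, rfl⟩ := h
  exact ⟨fibMorphism t, (fibMorphism_append u t).symm⟩

theorem fibIter_prefix_succ (n : ℕ) : fibIter n <+: fibIter (n + 1) := by
  induction n with
  | zero => exact ⟨[1], rfl⟩
  | succ n ih =>
    rw [fibIter_succ n, fibIter_succ (n + 1)]
    exact fibMorphism_prefix ih

theorem fibIter_prefix_of_le {m n : ℕ} (h : m ≤ n) : fibIter m <+: fibIter n :=
  Nat.le_induction List.prefix_rfl (fun k _ ih => ih.trans (fibIter_prefix_succ k)) n h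

theorem getElem_fibIter {n i : ℕ} (hi : i < (fibIter n).length) : (fibIter n)[i] = fibWord i := by
  rcases le_total i n with hin | hni
  · exact ((fibIter_prefix_of_le hin).getElem (lt_length_fibIter i)).symm
  · exact (fibIter_prefix_of_le hni).getElem hi

theorem occursAt_fibIter (n : ℕ) : OccursAt fibWord (fibIter n) 0 := by
  refine List.ext_getElem (length_slice _ _ _) fun i _ hi => ?_
  simp [slice, getElem_fibIter hi]

theorem OccursAt.fibMorphism {u : List (Fin 2)} (hu : OccursAt fibWord u 0) :
    OccursAt fibWord (fibMorphism u) 0 := by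
  have hpre : u <+: fibIter u.length :=
    hu.prefix_of_length_le (occursAt_fibIter _) (lt_length_fibIter _).le
  obtain ⟨t, ht⟩ := fibMorphism_prefix hpre
  have hiter := occursAt_fibIter (u.length + 1)
  rw [fibIter_succ, ← ht] at hiter
  exact (occursAt_append_iff.1 hiter).1

end FixedPoint

section Blocks

/-- The index at which the image of the letter number `n` starts when the Fibonacci word is read as
its own image under the Fibonacci morphism. -/
def blockStart (n : ℕ) : ℕ := (fibMorphism (slice fibWord 0 n)).length

/-- The number of zeros among the first `n` letters of the Fibonacci word. -/
def zeroCount (n : ℕ) : ℕ := Nat.count (fun i => fibWord i = 0) n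

theorem occursAt_fibLetter_blockStart (n : ℕ) :
    OccursAt fibWord (fibLetter (fibWord n)) (blockStart n) := by
  have h := (occursAt_slice fibWord 0 (n + 1)).fibMorphism
  rw [slice_succ, fibMorphism_append, fibMorphism_singleton, occursAt_append_iff] at h
  simpa only [blockStart, zero_add] using h.2

theorem blockStart_succ (n : ℕ) :
    blockStart (n + 1) = blockStart n + if fibWord n = 0 then 2 else 1 := by
  rw [blockStart, slice_succ, fibMorphism_append, List.length_append, fibMorphism_singleton,
    zero_add, fibLetter, blockStart]
  split <;> rfl

theorem blockStart_strictMono : StrictMono blockStart :=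
  strictMono_nat_of_lt_succ fun n => by rw [blockStart_succ]; split <;> omega

theorem blockStart_eq_add_zeroCount (n : ℕ) : blockStart n = n + zeroCount n := by
  induction n with
  | zero => rfl
  | succ n ih =>
    rw [blockStart_succ, ih, zeroCount, zeroCount, Nat.count_succ]
    split <;> omega

theorem fibWord_blockStart (n : ℕ) : fibWord (blockStart n) = 0 := by
  have h := occursAt_fibLetter_blockStart n
  rw [fibLetter] at h
  split at h <;> exact (occursAt_cons_iff.1 h).1

theorem fibWord_blockStart_add_one_eq_one_iff {n : ℕ} :
    fibWord (blockStart n + 1) = 1 ↔ fibWord n = 0 := by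
  by_cases hn : fibWord n = 0
  · have h := occursAt_fibLetter_blockStart n
    rw [fibLetter, if_pos hn, occursAt_cons_iff, occursAt_singleton_iff] at h
    exact iff_of_true h.2 hn
  · have h := fibWord_blockStart (n + 1)
    rw [blockStart_succ, if_neg hn] at h
    simp [h, hn]

theorem exists_eq_blockStart_or (p : ℕ) :
    ∃ k, p = blockStart k ∨ fibWord k = 0 ∧ p = blockStart k + 1 := by
  induction p with
  | zero => exact ⟨0, Or.inl rfl⟩
  | succ p ih =>
    obtain ⟨k, rfl | ⟨hk, rfl⟩⟩ := ih
    · by_cases hk : fibWord k = 0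
      · exact ⟨k, Or.inr ⟨hk, rfl⟩⟩
      · exact ⟨k + 1, Or.inl (by rw [blockStart_succ, if_neg hk])⟩
    · exact ⟨k + 1, Or.inl (by rw [blockStart_succ, if_pos hk])⟩

theorem fibWord_eq_zero_iff {p : ℕ} : fibWord p = 0 ↔ p ∈ Set.range blockStart := by
  refine ⟨fun hp => ?_, ?_⟩
  · obtain ⟨k, rfl | ⟨hk, rfl⟩⟩ := exists_eq_blockStart_or p
    · exact ⟨k, rfl⟩
    · simp [fibWord_blockStart_add_one_eq_one_iff.2 hk] at hp
  · rintro ⟨k, rfl⟩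
    exact fibWord_blockStart k

theorem fibWord_eq_one_iff {p : ℕ} :
    fibWord p = 1 ↔ ∃ k, fibWord k = 0 ∧ p = blockStart k + 1 := by
  refine ⟨fun hp => ?_, ?_⟩
  · obtain ⟨k, rfl | hk⟩ := exists_eq_blockStart_or p
    · simp [fibWord_blockStart] at hp
    · exact ⟨k, hk⟩
  · rintro ⟨k, hk, rfl⟩
    exact fibWord_blockStart_add_one_eq_one_iff.2 hk

theorem zeroCount_blockStart (n : ℕ) : zeroCount (blockStart n) = n := by
  have hinf : {i | fibWord i = 0}.Infinite :=
    Set.infinite_of_injective_forall_mem blockStart_strictMono.injective fibWord_blockStart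
  rw [← nth_eq_of_strictMono blockStart_strictMono (fun _ => fibWord_eq_zero_iff) n]
  exact Nat.count_nth_of_infinite hinf n

theorem zeroCount_blockStart_add_one (n : ℕ) : zeroCount (blockStart n + 1) = n + 1 := by
  rw [zeroCount, Nat.count_succ, if_pos (fibWord_blockStart n), ← zeroCount, zeroCount_blockStart]

end Blocks

section Desubstitution

/-- The word `u` such that `w` is obtained from `fibMorphism u ++ [0]` by removing at most its last
letter, for a factor `w` of the Fibonacci word that starts with `0`. The value on the other words is
immaterial. -/
def desubstitute : List (Fin 2) → List (Fin 2)
  | 0 :: 1 :: w => 0 :: desubstitute w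
  | 0 :: 0 :: w => 1 :: desubstitute (0 :: w)
  | _ => []

theorem length_desubstitute_le (w : List (Fin 2)) :
    (desubstitute w).length ≤ w.length - 1 := by
  fun_induction desubstitute w <;> grind

theorem occursAt_zero_one_cons_blockStart_iff {w : List (Fin 2)} {k : ℕ} :
    OccursAt fibWord (0 :: 1 :: w) (blockStart k) ↔
      fibWord k = 0 ∧ OccursAt fibWord w (blockStart (k + 1)) := by
  simp only [occursAt_cons_iff, fibWord_blockStart, fibWord_blockStart_add_one_eq_one_iff,
    true_and]
  refine and_congr_right fun hk => ?_
  rw [blockStart_succ, if_pos hk]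

theorem occursAt_zero_zero_cons_blockStart_iff {w : List (Fin 2)} {k : ℕ} :
    OccursAt fibWord (0 :: 0 :: w) (blockStart k) ↔
      fibWord k = 1 ∧ OccursAt fibWord (0 :: w) (blockStart (k + 1)) := by
  by_cases hk : fibWord k = 0
  · simp [occursAt_cons_iff, hk, fibWord_blockStart_add_one_eq_one_iff.2 hk]
  · rw [occursAt_cons_iff, blockStart_succ, if_neg hk]
    simp only [fibWord_blockStart, Fin.eq_one_of_ne_zero _ hk, true_and]

theorem occursAt_one_cons_iff {w : List (Fin 2)} {p : ℕ} :
    OccursAt fibWord (1 :: w) p ↔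
      ∃ k, OccursAt fibWord (0 :: 1 :: w) (blockStart k) ∧ p = blockStart k + 1 := by
  rw [occursAt_cons_iff, fibWord_eq_one_iff]
  constructor
  · rintro ⟨⟨k, hk, rfl⟩, hw⟩
    refine ⟨k, occursAt_cons_iff.2 ⟨fibWord_blockStart k, occursAt_cons_iff.2 ⟨?_, hw⟩⟩, rfl⟩
    exact fibWord_blockStart_add_one_eq_one_iff.2 hk
  · rintro ⟨k, hk, rfl⟩
    have hw := occursAt_cons_iff.1 (occursAt_cons_iff.1 hk).2
    exact ⟨⟨k, fibWord_blockStart_add_one_eq_one_iff.1 hw.1, rfl⟩, hw.2⟩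

theorem occursAt_blockStart_iff {w : List (Fin 2)} {i : ℕ} (hi : OccursAt fibWord w (blockStart i))
    (j : ℕ) : OccursAt fibWord w (blockStart j) ↔ OccursAt fibWord (desubstitute w) j := by
  fun_induction desubstitute w generalizing i j with
  | case1 w ih =>
    rw [occursAt_zero_one_cons_blockStart_iff] at hi ⊢
    rw [occursAt_cons_iff, ih hi.2]
  | case2 w ih =>
    rw [occursAt_zero_zero_cons_blockStart_iff] at hi ⊢
    rw [occursAt_cons_iff (w := desubstitute _), ih hi.2]
  | case3 w h01 h00 =>
    refine iff_of_true ?_ (occursAt_nil _ _)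
    rcases w with _ | ⟨a, w⟩
    · exact occursAt_nil _ _
    · obtain rfl : a = 0 := (occursAt_cons_iff.1 hi).1.symm.trans (fibWord_blockStart i)
      rcases w with _ | ⟨b, w⟩
      · exact occursAt_singleton_iff.2 (fibWord_blockStart j)
      · rcases eq_or_ne b 0 with rfl | hb
        · exact absurd rfl (h00 w)
        · exact absurd (by rw [Fin.eq_one_of_ne_zero b hb]) (h01 w)

/-- The bound on `k + u.length` makes a descent on the end of an occurrence possible; the length
alone need not drop, as for `w = [1]`, where `u = [0]`. -/
theorem exists_desubstitution {w : List (Fin 2)} {i : ℕ} (hne : w ≠ [])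
    (hi : OccursAt fibWord w i) :
    ∃ (u : List (Fin 2)) (k δ : ℕ), OccursAt fibWord u k ∧ k + u.length < i + w.length ∧ δ ≤ 1 ∧
      ∀ p, OccursAt fibWord w p ↔ ∃ j, OccursAt fibWord u j ∧ p = blockStart j + δ := by
  obtain ⟨a, w, rfl⟩ := List.exists_cons_of_ne_nil hne
  have le_blockStart (k : ℕ) : k ≤ blockStart k := blockStart_strictMono.le_apply
  rcases eq_or_ne a 0 with rfl | ha
  · obtain ⟨k, rfl⟩ := fibWord_eq_zero_iff.1 (occursAt_cons_iff.1 hi).1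
    have hlen := length_desubstitute_le (0 :: w)
    have hk := le_blockStart k
    refine ⟨desubstitute (0 :: w), k, 0, (occursAt_blockStart_iff hi k).1 hi, ?_, zero_le_one,
      fun p => ⟨fun hp => ?_, ?_⟩⟩
    · rw [List.length_cons] at hlen ⊢
      omega
    · obtain ⟨j, rfl⟩ := fibWord_eq_zero_iff.1 (occursAt_cons_iff.1 hp).1
      exact ⟨j, (occursAt_blockStart_iff hi j).1 hp, rfl⟩
    · rintro ⟨j, hj, rfl⟩
      exact (occursAt_blockStart_iff hi j).2 hj
  · obtain rfl := Fin.eq_one_of_ne_zero a ha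
    obtain ⟨k, hk, rfl⟩ := occursAt_one_cons_iff.1 hi
    have hlen := length_desubstitute_le (0 :: 1 :: w)
    have hk' := le_blockStart k
    refine ⟨desubstitute (0 :: 1 :: w), k, 1, (occursAt_blockStart_iff hk k).1 hk, ?_, le_rfl,
      fun p => ?_⟩
    · rw [List.length_cons] at hlen
      omega
    · simp only [occursAt_one_cons_iff, occursAt_blockStart_iff hk]

end Desubstitution

section Occurrences

/-- The sequences `a Z(t) + b t + c`, where `Z = zeroCount`. Because of
`floor_succ_mul_goldenRatio` they are generalized Beatty sequences for the golden ratio, up to a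
shift of the index. -/
def IsZeroCountAffine (f : ℕ → ℕ) : Prop :=
  ∃ a b c : ℕ, ∀ t, f t = a * zeroCount t + b * t + c

theorem isZeroCountAffine_id : IsZeroCountAffine id := ⟨0, 1, 0, fun t => by simp⟩

theorem isZeroCountAffine_zeroCount : IsZeroCountAffine zeroCount := ⟨1, 0, 0, fun t => by simp⟩

namespace IsZeroCountAffine

variable {f g : ℕ → ℕ}

theorem add (hf : IsZeroCountAffine f) (hg : IsZeroCountAffine g) :
    IsZeroCountAffine fun t => f t + g t := by
  obtain ⟨a, b, c, hf⟩ := hf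
  obtain ⟨a', b', c', hg⟩ := hg
  exact ⟨a + a', b + b', c + c', fun t => by simp only [hf, hg]; ring⟩

theorem add_const (hf : IsZeroCountAffine f) (d : ℕ) : IsZeroCountAffine fun t => f t + d := by
  obtain ⟨a, b, c, hf⟩ := hf
  exact ⟨a, b, c + d, fun t => by simp only [hf, add_assoc]⟩

end IsZeroCountAffine

theorem zeroCount_blockStart_add {δ : ℕ} (hδ : δ ≤ 1) (n : ℕ) :
    zeroCount (blockStart n + δ) = n + δ := by
  obtain rfl | rfl := Nat.le_one_iff_eq_zero_or_eq_one.1 hδ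
  · exact zeroCount_blockStart n
  · exact zeroCount_blockStart_add_one n

theorem exists_isZeroCountAffine_occursAt_iff {w : List (Fin 2)} {i : ℕ}
    (hi : OccursAt fibWord w i) :
    ∃ f : ℕ → ℕ, StrictMono f ∧ IsZeroCountAffine f ∧ IsZeroCountAffine (fun t => zeroCount (f t)) ∧
      ∀ p, OccursAt fibWord w p ↔ p ∈ Set.range f := by
  induction hN : i + w.length using Nat.strong_induction_on generalizing i w with
  | _ N ih =>
    rcases eq_or_ne w [] with rfl | hne
    · exact ⟨id, strictMono_id, isZeroCountAffine_id, isZeroCountAffine_zeroCount,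
        fun p => by simp [occursAt_nil]⟩
    · obtain ⟨u, k, δ, hk, hlt, hδ, hocc⟩ := exists_desubstitution hne hi
      obtain ⟨g, hmono, hg, hzg, hrange⟩ := ih _ (hN ▸ hlt) hk rfl
      refine ⟨fun t => blockStart (g t) + δ, (blockStart_strictMono.comp hmono).add_const δ,
        ?_, ?_, fun p => ?_⟩
      · simp only [blockStart_eq_add_zeroCount]
        exact (hg.add hzg).add_const δ
      · simp only [zeroCount_blockStart_add hδ]
        exact hg.add_const δ
      · simp only [hocc, hrange, Set.mem_range, exists_exists_eq_and, eq_comm (b := p)]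

theorem infinite_occursAt {w : List (Fin 2)} (hw : IsFactor fibWord w) :
    {i | OccursAt fibWord w i}.Infinite := by
  obtain ⟨i, hi⟩ := hw
  obtain ⟨f, hmono, -, -, hrange⟩ := exists_isZeroCountAffine_occursAt_iff hi
  exact Set.infinite_of_injective_forall_mem hmono.injective fun t => (hrange _).2 ⟨t, rfl⟩

theorem occurrence_eq_length_returnWord {w : List (Fin 2)} (hw : IsFactor fibWord w) (n : ℕ) :
    (occurrence fibWord w n : ℤ) = (returnWord fibWord w 0).length +
      ((returnWord fibWord w 1).length - (returnWord fibWord w 2).length) * zeroCount n +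
      (returnWord fibWord w 2).length * n := by
  obtain ⟨i, hi⟩ := hw
  obtain ⟨f, hmono, ⟨a, b, c, hf⟩, -, hrange⟩ := exists_isZeroCountAffine_occursAt_iff hi
  have hocc (t : ℕ) : occurrence fibWord w t = a * zeroCount t + b * t + c :=
    (nth_eq_of_strictMono hmono hrange t).trans (hf t)
  have hz₀ : zeroCount 0 = 0 := zeroCount_blockStart 0
  have hz₁ : zeroCount 1 = 1 := zeroCount_blockStart_add_one 0
  have hz₂ : zeroCount 2 = 1 := zeroCount_blockStart 1
  have hr₀ : (returnWord fibWord w 0).length = c := by simp [returnWord, length_slice, hocc, hz₀]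
  have hr₁ : (returnWord fibWord w 1).length = a + b := by
    simp [returnWord, length_slice, hocc, hz₀, hz₁]
  have hr₂ : (returnWord fibWord w 2).length = b := by
    simp only [returnWord, length_slice, hocc, Nat.reduceAdd, hz₁, hz₂]
    omega
  rw [hr₀, hr₁, hr₂, hocc]
  push_cast
  ring

end Occurrences

section Wythoff

open Real

theorem lt_blockStart {n : ℕ} (hn : 0 < n) : n < blockStart n := by
  have hle : zeroCount 1 ≤ zeroCount n := Nat.count_monotone _ hn
  have hone : zeroCount 1 = 1 := zeroCount_blockStart_add_one 0
  rw [blockStart_eq_add_zeroCount]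
  omega

theorem succ_mul_goldenRatio_mem_Ioo (n : ℕ) :
    (n + 1) * goldenRatio ∈ Set.Ioo (blockStart n + 1 : ℝ) (blockStart n + 2) := by
  have hφ₁ := one_lt_goldenRatio
  have hφ₂ := goldenRatio_lt_two
  induction n using Nat.strong_induction_on with
  | _ n ih =>
    rcases n.eq_zero_or_pos with rfl | hn
    · have h₀ : blockStart 0 = 0 := rfl
      simp only [h₀, Nat.cast_zero, zero_add, one_mul]
      exact ⟨hφ₁, hφ₂⟩
    · obtain ⟨k, hk⟩ := exists_eq_blockStart_or n
      have hkn : k < n := by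
        rcases k.eq_zero_or_pos with rfl | hpos
        · exact hn
        · have := lt_blockStart hpos
          omega
      obtain ⟨hlo, hhi⟩ := ih k hkn
      -- `φ⁻¹ = φ - 1` turns the bounds on `(k + 1)φ` into bounds on multiples of `φ`.
      have hinv : goldenRatio * (goldenRatio - 1) = 1 := by linear_combination goldenRatio_sq
      have hupper : (blockStart k + 1) * goldenRatio < blockStart k + k + 2 := by
        linear_combination (goldenRatio - 1) * hlo + (k + 1) * hinv
      have hlower : blockStart k + k + 3 < (blockStart k + 2) * goldenRatio := by
        linear_combination (goldenRatio - 1) * hhi - (k + 1) * hinv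
      rcases hk with rfl | ⟨-, rfl⟩
      · rw [blockStart_eq_add_zeroCount (blockStart k), zeroCount_blockStart]
        push_cast
        constructor <;> linarith
      · rw [blockStart_eq_add_zeroCount (blockStart k + 1), zeroCount_blockStart_add_one]
        push_cast
        constructor <;> linarith

theorem floor_succ_mul_goldenRatio (n : ℕ) :
    ⌊((n + 1 : ℕ) : ℝ) * goldenRatio⌋ = (blockStart n + 1 : ℤ) := by
  obtain ⟨hlo, hhi⟩ := succ_mul_goldenRatio_mem_Ioo n
  rw [Int.floor_eq_iff]
  push_cast
  constructor <;> linarith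

end Wythoff

section Transform

variable {w : List (Fin 2)}

theorem transform_eq_two_iff {k : ℕ} :
    transform w k = 2 ↔ OccursAt fibWord w (readIndex w k) := by
  unfold transform
  split_ifs with h
  · exact iff_of_true rfl h
  · exact iff_of_false (Fin.castSucc_ne_last _) h

theorem readIndex_add_count (w : List (Fin 2)) (k : ℕ) :
    readIndex w k + Nat.count (fun m => transform w m = 2) k =
      k + w.length * Nat.count (fun m => transform w m = 2) k := by
  induction k with
  | zero => rfl
  | succ k ih =>
    simp only [readIndex, Nat.count_succ, transform_eq_two_iff] at ih ⊢
    split <;> linarith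

theorem readIndex_strictMono (hne : w ≠ []) : StrictMono (readIndex w) := by
  have hpos := List.length_pos_of_ne_nil hne
  refine strictMono_nat_of_lt_succ fun k => ?_
  rw [readIndex]
  split <;> omega

theorem mem_range_readIndex (hne : w ≠ []) (hov : ¬ HasOverlap fibWord w) {p : ℕ}
    (hp : OccursAt fibWord w p) : p ∈ Set.range (readIndex w) := by
  by_contra hrange
  have hlt (k : ℕ) : readIndex w k < p := by
    induction k with
    | zero => exact Nat.pos_of_ne_zero fun h => hrange ⟨0, h.symm⟩
    | succ k ih =>
      refine lt_of_le_of_ne ?_ fun h => hrange ⟨k + 1, h⟩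
      rw [readIndex]
      split_ifs with hk
      · exact add_length_le_of_not_hasOverlap hov ih hk hp
      · exact ih
  exact (hlt p).not_ge (readIndex_strictMono hne).le_apply

theorem infinite_transform_eq_two (hne : w ≠ []) (hw : IsFactor fibWord w)
    (hov : ¬ HasOverlap fibWord w) : {k | transform w k = 2}.Infinite := by
  simp only [transform_eq_two_iff]
  exact (infinite_occursAt hw).preimage fun p hp => mem_range_readIndex hne hov hp

theorem readIndex_nth_transform (hne : w ≠ []) (hw : IsFactor fibWord w)
    (hov : ¬ HasOverlap fibWord w) (n : ℕ) :
    readIndex w (Nat.nth (fun k => transform w k = 2) n) = occurrence fibWord w n := by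
  simp only [transform_eq_two_iff]
  exact Nat.nth_comp_of_strictMono (readIndex_strictMono hne)
    (fun p hp => mem_range_readIndex hne hov hp) fun hfin => absurd hfin (infinite_occursAt hw)

theorem positionSeq_transform (hne : w ≠ []) (hw : IsFactor fibWord w)
    (hov : ¬ HasOverlap fibWord w) (n : ℕ) :
    positionSeq (transform w) 2 (n + 1) + w.length * n = occurrence fibWord w n + n + 1 := by
  have hinf := infinite_transform_eq_two hne hw hov
  have hread := readIndex_add_count w (Nat.nth (fun k => transform w k = 2) n)
  rw [Nat.count_nth_of_infinite hinf, readIndex_nth_transform hne hw hov] at hread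
  rw [positionSeq_succ hinf]
  omega

end Transform

end FibKimberling

open FibKimberling

theorem mainTheorem11 (w : List (Fin 2)) (hne : w ≠ [])
    (hw : FibKimberling.IsFactor FibKimberling.fibWord w)
    (hov : ¬ FibKimberling.HasOverlap FibKimberling.fibWord w) :
    {m : ℕ | FibKimberling.IsPosition (FibKimberling.transform w) 2 m}.Infinite ∧
    ∀ l₀ l₁ l₂ : ℤ,
      l₀ = (FibKimberling.returnWord FibKimberling.fibWord w 0).length →
      l₁ = (FibKimberling.returnWord FibKimberling.fibWord w 1).length - w.length + 1 →
      l₂ = (FibKimberling.returnWord FibKimberling.fibWord w 2).length - w.length + 1 →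
      ∀ n : ℕ, 1 ≤ n →
        (FibKimberling.positionSeq (FibKimberling.transform w) 2 n : ℤ) =
          FibKimberling.generalizedBeatty Real.goldenRatio
            (l₁ - l₂) (2 * l₂ - l₁) (l₀ - l₂ + 1) n := by
  refine ⟨infinite_isPosition (infinite_transform_eq_two hne hw hov), ?_⟩
  rintro l₀ l₁ l₂ rfl rfl rfl n hn
  obtain ⟨t, rfl⟩ := Nat.exists_eq_add_of_le' hn
  have hpos := congrArg (Nat.cast : ℕ → ℤ) (positionSeq_transform hne hw hov t)
  push_cast [occurrence_eq_length_returnWord hw] at hpos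
  rw [generalizedBeatty, floor_succ_mul_goldenRatio, blockStart_eq_add_zeroCount]
  push_cast
  linear_combination hpos
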